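/- Let $K=(X,\delta,m)$ be a weighted cell complex, that is: $X=\dot\bigcup_{k\ge 0}X_k$ is a finite set of cells (write $\dim x=k$ for $x\in X_k$), $m:X\to(0,\infty)$ is a weight, and $\delta:C(X)\to C(X)$ is a linear operator on $C(X)=\mathbb R^X$. A cell $x$ is identified with its indicator function $1_x\in C(X)$, and $x\lessdot z$ (or $z\gtrdot x$) means $\delta x(z)\neq 0$. It is required that for all $v,z,z'\in X$: - $\delta v(z)\in\{-1,0,1\}$; $\delta v(z)=0$ unless $\dim z-\dim v=1$; if $\dim z\ge 1$, there is some $x\lessdot z$; - every $x\in X_1$ has exactly one $w\in X_0$ with $\delta w(x)=1$ and exactly one $w\in X_0$ with $\delta w(x)=-1$; - if $\dim z-\dim v=2$ and $\{x: v\lessdot x\lessdot z\}\ne\emptyset$, then this set has exactly two elements and $\{\delta v(x)\,\delta x(z):x\in X\}\supseteq\{-1,1\}$; - for all $x,y\lessdot z$ there is a sequence $x=x_0,\dots,x_n=y$ in $X$ with $\delta x_k(x_{k-1})+\delta x_{k-1}(x_k)\neq 0$ for $k=1,\dots,n$; - if $\{x:x\lessdot z\}=\{x:x\lessdot z'\}$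 and $\dim z\ge 1$, then $z=z'$. Let $\delta^*$ be the adjoint of $\delta$ with respect to $\langle f,g\rangle=\sum_{x\in X} f(x)g(x)m(x)$, let $H=\delta\delta^*+\delta^*\delta$ be the Hodge Laplacian, and define the Forman curvature of a cell $x$ by $$F(x)=Hx(x)-\sum_{y\ne x}|Hy(x)|.$$ For $x\in X$ and $k\ge 0$ put $$\operatorname{Deg}(x)=\sum_{z\gtrdot x}\frac{m(z)}{m(x)}+\max_{v\lessdot x}\frac{m(x)}{m(v)},\qquad D_k=\max_{x\in X_k}\operatorname{Deg}(x),$$ where a maximum over the empty set is $0$. Write $x\sim y$ if there is $z$ with $x,y\lessdot z$ or $v$ with $v\lessdot x,y$; let $d(x,y)\in\{0,1,2,\dots\}\cup\{\infty\}$ be the least $n$ for which there is a path $x=x_0\sim\dots\sim x_n=y$ ($\infty$ if there is none), and let $\operatorname{diam}=\sup_{v,w\in X_0}d(v,w)$, with $\operatorname{diam}=0$ if $X_0=\emptyset$. **Theorem.** Suppose that $F(x)\ge R>0$ for all $x\in X_1$. Then any two vertices $v,w\in X_0$ with $d(v,w)<\infty$ satisfy $$d(v,w)\le\frac{2\min(D_1,D_0)}{R}.$$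 In particular, if any two vertices of $K$ can be joined by a path, then $$\operatorname{diam}\le\frac{2\min(D_1,D_0)}{R}.$$ -/

import Mathlib

noncomputable section

open scoped BigOperators

namespace FormanDiam

variable {X : Type*}

open Classical in
/-- The indicator function of a cell, by which a cell is regarded as an element of `C(X)`. -/
def cellVec (x : X) : X → ℝ := fun y => if y = x then 1 else 0

/-- The coefficient `δ v (z)` of a linear operator `δ` on `C(X)`. -/
def coeff (δ : (X → ℝ) →ₗ[ℝ] (X → ℝ)) (v z : X) : ℝ := δ (cellVec v) z

/-- A weighted (combinatorial) cell complex with set of cells `X`. The set `X_k` of `k`-cells is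
`{x | dim x = k}`. -/
structure CellComplex (X : Type*) [Fintype X] where
  dim : X → ℕ
  /-- The coboundary operator. -/
  δ : (X → ℝ) →ₗ[ℝ] (X → ℝ)
  /-- The cell weight. -/
  m : X → ℝ
  m_pos : ∀ x, 0 < m x
  coeff_mem : ∀ v z, coeff δ v z ∈ ({-1, 0, 1} : Set ℝ)
  coeff_dim : ∀ v z, dim z ≠ dim v + 1 → coeff δ v z = 0
  exists_face : ∀ z, 1 ≤ dim z → ∃ x, coeff δ x z ≠ 0
  edge_pos : ∀ x, dim x = 1 → {w | dim w = 0 ∧ coeff δ w x = 1}.ncard = 1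
  edge_neg : ∀ x, dim x = 1 → {w | dim w = 0 ∧ coeff δ w x = -1}.ncard = 1
  diamond_card : ∀ v z, dim z = dim v + 2 →
    {x | coeff δ v x ≠ 0 ∧ coeff δ x z ≠ 0}.Nonempty →
    {x | coeff δ v x ≠ 0 ∧ coeff δ x z ≠ 0}.ncard = 2
  diamond_sign : ∀ v z, dim z = dim v + 2 →
    {x | coeff δ v x ≠ 0 ∧ coeff δ x z ≠ 0}.Nonempty →
    ({-1, 1} : Set ℝ) ⊆ Set.range fun x => coeff δ v x * coeff δ x z
  face_connected : ∀ x y z, coeff δ x z ≠ 0 → coeff δ y z ≠ 0 →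
    ∃ (n : ℕ) (p : ℕ → X), p 0 = x ∧ p n = y ∧
      ∀ k < n, coeff δ (p (k + 1)) (p k) + coeff δ (p k) (p (k + 1)) ≠ 0
  eq_of_faces : ∀ z z', 1 ≤ dim z →
    {x | coeff δ x z ≠ 0} = {x | coeff δ x z' ≠ 0} → z = z'

namespace CellComplex

variable [Fintype X] (K : CellComplex X)

/-- `K.IsFace x z` means that `x` is a codimension-one face of `z`, i.e. `δ x (z) ≠ 0`. -/
def IsFace (x z : X) : Prop := coeff K.δ x z ≠ 0

/-- The scalar product of `C(X)` given by the weight. -/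
def innerProd (f g : X → ℝ) : ℝ := ∑ x, f x * g x * K.m x

/-- The adjoint of the coboundary operator with respect to `innerProd`
(see `innerProd_δ` for the adjunction). -/
def δadj : (X → ℝ) →ₗ[ℝ] (X → ℝ) where
  toFun f x := ∑ z, f z * (K.m z / K.m x) * coeff K.δ x z
  map_add' f g := by
    funext x
    simp only [Pi.add_apply, add_mul, Finset.sum_add_distrib]
  map_smul' c f := by
    funext x
    simp only [Pi.smul_apply, smul_eq_mul, RingHom.id_apply, Finset.mul_sum, mul_assoc]

lemma δ_apply (f : X → ℝ) (z : X) : K.δ f z = ∑ x, f x * coeff K.δ x z := by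
  have h : f = ∑ x, f x • cellVec x := by
    funext y
    rw [Finset.sum_apply, Finset.sum_eq_single y]
    · simp [cellVec]
    · intro b _ hb
      simp [cellVec, hb.symm]
    · simp
  conv_lhs => rw [h]
  simp [map_sum, coeff]

/-- `δadj` is the adjoint of `δ`. -/
lemma innerProd_δ (f g : X → ℝ) :
    K.innerProd (K.δ f) g = K.innerProd f (K.δadj g) := by
  simp only [innerProd, δ_apply, δadj, LinearMap.coe_mk, AddHom.coe_mk, Finset.sum_mul,
    Finset.mul_sum]
  rw [Finset.sum_comm]
  refine Finset.sum_congr rfl fun x _ => Finset.sum_congr rfl fun z _ => ?_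
  have := (K.m_pos x).ne'
  field_simp

/-- The Hodge Laplacian. -/
def hodge : (X → ℝ) →ₗ[ℝ] (X → ℝ) := K.δ ∘ₗ K.δadj + K.δadj ∘ₗ K.δ

open Classical in
/-- The Forman curvature of a cell. -/
def forman (x : X) : ℝ :=
  coeff K.hodge x x - ∑ y ∈ Finset.univ.filter (fun y => y ≠ x), |coeff K.hodge y x|

open Classical in
/-- The degree of a cell. The supremum is a maximum over a finite set; it is `0` for cells
without faces, that is, for vertices. -/
def deg (x : X) : ℝ :=
  ∑ z ∈ Finset.univ.filter (fun z => K.IsFace x z), K.m z / K.m x +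
    ⨆ v : {v : X // K.IsFace v x}, K.m x / K.m v

/-- The maximal degree `D_k` of the `k`-cells (`0` if there are none). -/
def maxDeg (k : ℕ) : ℝ := ⨆ x : {x : X // K.dim x = k}, K.deg x

/-- Adjacency of cells: they have a common coface or a common face. -/
def Adj (x y : X) : Prop :=
  (∃ z, K.IsFace x z ∧ K.IsFace y z) ∨ (∃ v, K.IsFace v x ∧ K.IsFace v y)

/-- There is a path of length `n` from `x` to `y`. -/
def HasPath (x y : X) (n : ℕ) : Prop :=
  ∃ p : ℕ → X, p 0 = x ∧ p n = y ∧ ∀ k < n, K.Adj (p k) (p (k + 1))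

/-- The combinatorial path distance, infinite if there is no path. -/
def cdist (x y : X) : ℕ∞ := ⨅ (n : ℕ) (_ : K.HasPath x y n), (n : ℕ∞)

/-- The combinatorial diameter of the vertex set. -/
def diam : ℕ∞ :=
  ⨆ (v : {v : X // K.dim v = 0}) (w : {w : X // K.dim w = 0}), K.cdist v w

/-- Any two vertices can be joined by a path. -/
def Connected : Prop := ∀ v w, K.dim v = 0 → K.dim w = 0 → ∃ n, K.HasPath v w n

end CellComplex

end FormanDiam

end

namespace FormanDiam

/-! Let `f` be the distance from `v`. Then `|δ f| ≤ 1`, with equality on the edges of a geodesic, so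
the maximum principle `forman_le_mul_hodge` bounds the curvature there by `± H (δ f)`. Since `δ ∘ δ
= 0`, `H (δ f) = δ g` with `g = δ* δ f`; hence `g` grows by at least `R` along each geodesic edge
(`forman_le_sub`). At vertices `|g| ≤ D_0`, so a geodesic of length `n` gives `n R ≤ 2 D_0`. For
`D_1`, only the `n - 2` inner edges are treated this way. At each end edge, `forman_add_le_deg`
applies the maximum principle to `δ f` cut off at the outer vertex, which bounds `R ± g` at the
inner vertex by `D_1`. Adding up gives `n R ≤ 2 D_1`; the case `n = 1` is `forman_le_two_mul_deg`.
-/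

lemma abs_cellVec_le {X : Type*} (e y : X) : |cellVec e y| ≤ 1 := by
  unfold cellVec
  split_ifs <;> simp

namespace CellComplex

variable {X : Type*} [Fintype X] (K : CellComplex X)

/-! ### Vanishing of `δ ∘ δ` and the maximum principle -/

lemma δadj_apply (f : X → ℝ) (x : X) :
    K.δadj f x = ∑ z, f z * (K.m z / K.m x) * coeff K.δ x z := rfl

lemma IsFace.dim_eq {K : CellComplex X} {x z : X} (h : K.IsFace x z) :
    K.dim z = K.dim x + 1 := by
  by_contra hne
  exact h (K.coeff_dim x z hne)

lemma IsFace.coeff_eq {K : CellComplex X} {x z : X} (h : K.IsFace x z) :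
    coeff K.δ x z = 1 ∨ coeff K.δ x z = -1 := by
  rcases K.coeff_mem x z with h1 | h1 | h1
  · exact Or.inr h1
  · exact absurd h1 h
  · exact Or.inl h1

lemma IsFace.coeff_mul_self {K : CellComplex X} {x z : X} (h : K.IsFace x z) :
    coeff K.δ x z * coeff K.δ x z = 1 := by
  rcases h.coeff_eq with h1 | h1 <;> rw [h1] <;> norm_num

lemma IsFace.abs_coeff {K : CellComplex X} {x z : X} (h : K.IsFace x z) :
    |coeff K.δ x z| = 1 := by
  rcases h.coeff_eq with h1 | h1 <;> rw [h1] <;> norm_num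

lemma coeff_eq_zero {x z : X} (h : ¬ K.IsFace x z) : coeff K.δ x z = 0 := by
  simpa [IsFace] using h

/-- A nonempty diamond has exactly two middle cells, and their sign products realise both `1` and
`-1`, so they cancel. -/
lemma sum_coeff_mul_coeff (v z : X) : ∑ x, coeff K.δ v x * coeff K.δ x z = 0 := by
  classical
  by_cases hne : {x | coeff K.δ v x ≠ 0 ∧ coeff K.δ x z ≠ 0}.Nonempty
  · have hdim : K.dim z = K.dim v + 2 := by
      obtain ⟨x, h1, h2⟩ := hne
      have := IsFace.dim_eq (K := K) h1
      have := IsFace.dim_eq (K := K) h2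
      omega
    obtain ⟨p, q, hpq, hs⟩ := Set.ncard_eq_two.mp (K.diamond_card v z hdim hne)
    have hmem : ∀ x, coeff K.δ v x * coeff K.δ x z ≠ 0 → x = p ∨ x = q := by
      intro x hx
      have : x ∈ {x | coeff K.δ v x ≠ 0 ∧ coeff K.δ x z ≠ 0} :=
        ⟨left_ne_zero_of_mul hx, right_ne_zero_of_mul hx⟩
      rw [hs] at this
      simpa using this
    have hsum : ∑ x, coeff K.δ v x * coeff K.δ x z
        = coeff K.δ v p * coeff K.δ p z + coeff K.δ v q * coeff K.δ q z := by
      rw [← Finset.sum_pair (f := fun x => coeff K.δ v x * coeff K.δ x z) hpq]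
      symm
      apply Finset.sum_subset (Finset.subset_univ _)
      intro x _ hx
      by_contra h0
      exact hx (by simpa using hmem x h0)
    have hsign := K.diamond_sign v z hdim hne
    obtain ⟨i, hi⟩ := hsign (show (-1 : ℝ) ∈ ({-1, 1} : Set ℝ) by simp)
    obtain ⟨j, hj⟩ := hsign (show (1 : ℝ) ∈ ({-1, 1} : Set ℝ) by simp)
    simp only at hi hj
    rw [hsum]
    rcases hmem i (by rw [hi]; norm_num) with rfl | rfl <;>
      rcases hmem j (by rw [hj]; norm_num) with rfl | rfl <;> linarith
  · apply Finset.sum_eq_zero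
    intro x _
    by_contra h0
    exact hne ⟨x, left_ne_zero_of_mul h0, right_ne_zero_of_mul h0⟩

/-- The coboundary operator squares to zero. -/
lemma δ_δ (f : X → ℝ) : K.δ (K.δ f) = 0 := by
  funext z
  rw [δ_apply]
  simp only [δ_apply K f, Finset.sum_mul]
  rw [Finset.sum_comm]
  apply Finset.sum_eq_zero
  intro v _
  simp only [mul_assoc]
  rw [← Finset.mul_sum, sum_coeff_mul_coeff, mul_zero]

lemma hodge_apply (f : X → ℝ) : K.hodge f = K.δ (K.δadj f) + K.δadj (K.δ f) := rfl

lemma hodge_δ (f : X → ℝ) : K.hodge (K.δ f) = K.δ (K.δadj (K.δ f)) := by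
  rw [hodge_apply, δ_δ, map_zero, add_zero]

lemma linearMap_apply_eq_sum (T : (X → ℝ) →ₗ[ℝ] (X → ℝ)) (f : X → ℝ) (z : X) :
    T f z = ∑ x, f x * coeff T x z := by
  have h : f = ∑ x, f x • cellVec x := by
    funext y
    rw [Finset.sum_apply, Finset.sum_eq_single y]
    · simp [cellVec]
    · intro b _ hb
      simp [cellVec, hb.symm]
    · simp
  conv_lhs => rw [h]
  simp [map_sum, coeff]

/-- The maximum principle for the Hodge Laplacian. -/
lemma forman_le_mul_hodge {α : X → ℝ} {x : X} (hα : ∀ y, |α y| ≤ 1) (hx : |α x| = 1) :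
    K.forman x ≤ α x * K.hodge α x := by
  classical
  have hxx : α x * α x = 1 := by rw [← abs_mul_abs_self, hx, one_mul]
  rw [linearMap_apply_eq_sum, ← Finset.add_sum_erase _ _ (Finset.mem_univ x), mul_add, ← mul_assoc,
    hxx, one_mul, forman, sub_eq_add_neg, Finset.mul_sum, ← Finset.sum_neg_distrib]
  refine add_le_add le_rfl ?_
  convert Finset.sum_le_sum (s := Finset.univ.erase x)
    (f := fun y => -|coeff K.hodge y x|) fun y _ => ?_ using 1
  · refine Finset.sum_congr ?_ fun _ _ => rfl
    ext y
    simp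
  · have h1 : |α x * (α y * coeff K.hodge y x)| ≤ |coeff K.hodge y x| := by
      rw [abs_mul, abs_mul, hx, one_mul]
      exact mul_le_of_le_one_left (abs_nonneg _) (hα y)
    exact (abs_le.mp h1).1

/-! ### Edges and their end points -/

lemma eq_or_eq_of_isFace {e a b x : X} (hdim : K.dim e = 1) (ha : K.IsFace a e)
    (hb : K.IsFace b e) (hab : a ≠ b) (hx : K.IsFace x e) :
    (x = a ∨ x = b) ∧ coeff K.δ a e = -coeff K.δ b e := by
  obtain ⟨p, hp⟩ := Set.ncard_eq_one.mp (K.edge_pos e hdim)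
  obtain ⟨q, hq⟩ := Set.ncard_eq_one.mp (K.edge_neg e hdim)
  have hpos : ∀ y, K.IsFace y e → coeff K.δ y e = 1 → y = p := fun y hy h => by
    have : y ∈ {w | K.dim w = 0 ∧ coeff K.δ w e = 1} := ⟨by have := hy.dim_eq; omega, h⟩
    rwa [hp] at this
  have hneg : ∀ y, K.IsFace y e → coeff K.δ y e = -1 → y = q := fun y hy h => by
    have : y ∈ {w | K.dim w = 0 ∧ coeff K.δ w e = -1} := ⟨by have := hy.dim_eq; omega, h⟩
    rwa [hq] at this
  rcases ha.coeff_eq with h1 | h1 <;> rcases hb.coeff_eq with h2 | h2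
  · exact absurd ((hpos a ha h1).trans (hpos b hb h2).symm) hab
  · refine ⟨?_, by rw [h1, h2]; norm_num⟩
    rcases hx.coeff_eq with h3 | h3
    · exact Or.inl ((hpos x hx h3).trans (hpos a ha h1).symm)
    · exact Or.inr ((hneg x hx h3).trans (hneg b hb h2).symm)
  · refine ⟨?_, by rw [h1, h2]⟩
    rcases hx.coeff_eq with h3 | h3
    · exact Or.inr ((hpos x hx h3).trans (hpos b hb h2).symm)
    · exact Or.inl ((hneg x hx h3).trans (hneg a ha h1).symm)
  · exact absurd ((hneg a ha h1).trans (hneg b hb h2).symm) hab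

lemma exists_faces {e : X} (hdim : K.dim e = 1) : ∃ a b, a ≠ b ∧ K.IsFace a e ∧ K.IsFace b e := by
  obtain ⟨p, hp⟩ := Set.ncard_eq_one.mp (K.edge_pos e hdim)
  obtain ⟨q, hq⟩ := Set.ncard_eq_one.mp (K.edge_neg e hdim)
  have hp' : coeff K.δ p e = 1 := (hp.ge rfl).2
  have hq' : coeff K.δ q e = -1 := (hq.ge rfl).2
  refine ⟨p, q, ?_, ?_, ?_⟩
  · rintro rfl
    rw [hp'] at hq'
    norm_num at hq'
  · rw [IsFace, hp']; norm_num
  · rw [IsFace, hq']; norm_num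

/-- The coboundary on an edge is a difference of the values at its end points. -/
lemma δ_edge {e a b : X} (hdim : K.dim e = 1) (ha : K.IsFace a e) (hb : K.IsFace b e)
    (hab : a ≠ b) (h : X → ℝ) : K.δ h e = coeff K.δ b e * (h b - h a) := by
  classical
  rw [δ_apply, ← Finset.sum_subset (Finset.subset_univ {a, b}), Finset.sum_pair hab,
    (K.eq_or_eq_of_isFace hdim ha hb hab ha).2]
  · ring
  · intro x _ hx
    rw [K.coeff_eq_zero, mul_zero]
    intro hf
    exact hx (by simpa using (K.eq_or_eq_of_isFace hdim ha hb hab hf).1)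

/-- There are no multiple edges. -/
lemma edge_unique {e e' a b : X} (hdim : K.dim e = 1) (ha : K.IsFace a e) (hb : K.IsFace b e)
    (hab : a ≠ b) (ha' : K.IsFace a e') (hb' : K.IsFace b e') : e = e' := by
  have hdim' : K.dim e' = 1 := by have := ha.dim_eq; have := ha'.dim_eq; omega
  refine K.eq_of_faces e e' hdim.ge ?_
  ext x
  constructor <;> intro hx
  · rcases (K.eq_or_eq_of_isFace hdim ha hb hab hx).1 with rfl | rfl
    exacts [ha', hb']
  · rcases (K.eq_or_eq_of_isFace hdim' ha' hb' hab hx).1 with rfl | rfl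
    exacts [ha, hb]

/-! ### Degree bounds and curvature estimates on edges -/

open Classical in
lemma sum_div_le (x : X) {c : X → ℝ} (hc : ∀ z, K.IsFace x z → |c z| ≤ 1) :
    |∑ z, c z * (K.m z / K.m x) * coeff K.δ x z| ≤
      ∑ z ∈ Finset.univ.filter (fun z => K.IsFace x z), K.m z / K.m x := by
  rw [Finset.sum_filter]
  refine (Finset.abs_sum_le_sum_abs _ _).trans (Finset.sum_le_sum fun z _ => ?_)
  split_ifs with h
  · have h0 : 0 < K.m z / K.m x := div_pos (K.m_pos z) (K.m_pos x)
    rw [abs_mul, abs_mul, h.abs_coeff, mul_one, abs_of_pos h0]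
    exact mul_le_of_le_one_left h0.le (hc z h)
  · rw [K.coeff_eq_zero h, mul_zero, abs_zero]

lemma iSup_face_nonneg (x : X) : 0 ≤ ⨆ v : {v : X // K.IsFace v x}, K.m x / K.m v :=
  Real.iSup_nonneg fun v => (div_pos (K.m_pos x) (K.m_pos v)).le

lemma div_le_iSup_face {x v : X} (h : K.IsFace v x) :
    K.m x / K.m v ≤ ⨆ v : {v : X // K.IsFace v x}, K.m x / K.m v :=
  le_ciSup (f := fun v : {v : X // K.IsFace v x} => K.m x / K.m v)
    (Set.finite_range _).bddAbove ⟨v, h⟩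

lemma deg_nonneg (x : X) : 0 ≤ K.deg x :=
  add_nonneg (Finset.sum_nonneg fun z _ => (div_pos (K.m_pos z) (K.m_pos x)).le)
    (K.iSup_face_nonneg x)

lemma maxDeg_nonneg (k : ℕ) : 0 ≤ K.maxDeg k := Real.iSup_nonneg fun x => K.deg_nonneg x

lemma deg_le_maxDeg (x : X) : K.deg x ≤ K.maxDeg (K.dim x) :=
  le_ciSup (f := fun y : {y : X // K.dim y = K.dim x} => K.deg y)
    (Set.finite_range _).bddAbove ⟨x, rfl⟩

lemma abs_δadj_le_deg (x : X) {α : X → ℝ} (hα : ∀ y, |α y| ≤ 1) : |K.δadj α x| ≤ K.deg x :=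
  (K.sum_div_le x fun z _ => hα z).trans (le_add_of_nonneg_right (K.iSup_face_nonneg x))

lemma δadj_cellVec (e x : X) : K.δadj (cellVec e) x = K.m e / K.m x * coeff K.δ x e := by
  rw [δadj_apply, Finset.sum_eq_single e]
  · simp [cellVec]
  · intro y _ hy
    simp [cellVec, hy]
  · simp

/-- The maximum principle is tested on the indicator of `e`: each of the two end points contributes
at most the face maximum in the degree. It serves geodesics of one edge, whose two end edges
coincide. -/
lemma forman_le_two_mul_deg {e : X} (hdim : K.dim e = 1) : K.forman e ≤ 2 * K.deg e := by
  classical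
  obtain ⟨a, b, hab, ha, hb⟩ := K.exists_faces hdim
  have hone : (cellVec e : X → ℝ) e = 1 := by simp [cellVec]
  have h := K.forman_le_mul_hodge (α := cellVec e) (x := e) (abs_cellVec_le e)
    (by rw [hone, abs_one])
  rw [hone, one_mul, hodge_apply, Pi.add_apply, K.δ_edge hdim ha hb hab, δadj_cellVec,
    δadj_cellVec, (K.eq_or_eq_of_isFace hdim ha hb hab ha).2] at h
  have h1 : |K.δadj (K.δ (cellVec e)) e| ≤ _ := K.sum_div_le e fun z hz => hz.abs_coeff.le
  have h2 := (abs_le.mp h1).2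
  have h3 := K.div_le_iSup_face ha
  have h4 := K.div_le_iSup_face hb
  have h5 : coeff K.δ b e * (K.m e / K.m b * coeff K.δ b e - K.m e / K.m a * -coeff K.δ b e)
      = K.m e / K.m b + K.m e / K.m a := by
    linear_combination (K.m e / K.m b + K.m e / K.m a) * hb.coeff_mul_self
  have h6 : 0 ≤ ∑ z ∈ Finset.univ.filter (fun z => K.IsFace e z), K.m z / K.m e :=
    Finset.sum_nonneg fun z _ => (div_pos (K.m_pos z) (K.m_pos e)).le
  rw [deg]
  linarith

/-- The Laplacian of a function of slope one along an edge increases by the curvature. -/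
lemma forman_le_sub {f : X → ℝ} (hf : ∀ z, |K.δ f z| ≤ 1) {e a b : X} (hdim : K.dim e = 1)
    (ha : K.IsFace a e) (hb : K.IsFace b e) (hab : a ≠ b) (hfab : f b - f a = 1) :
    K.forman e ≤ K.δadj (K.δ f) b - K.δadj (K.δ f) a := by
  have he : K.δ f e = coeff K.δ b e := by rw [K.δ_edge hdim ha hb hab, hfab, mul_one]
  have h := K.forman_le_mul_hodge hf (x := e) (by rw [he, hb.abs_coeff])
  rwa [hodge_δ, he, K.δ_edge hdim ha hb hab, ← mul_assoc, hb.coeff_mul_self, one_mul] at h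

/-- The estimate at an end of a geodesic: it comes from the maximum principle for the cochain
that agrees with `δ f` except that it vanishes on the edges other than `e` at the vertex `b`. -/
lemma forman_add_le_deg {f : X → ℝ} (hf : ∀ z, |K.δ f z| ≤ 1) {e a b : X} (hdim : K.dim e = 1)
    (ha : K.IsFace a e) (hb : K.IsFace b e) (hab : a ≠ b) {σ : ℝ} (hσ : σ * σ = 1)
    (hfab : f b - f a = σ) :
    K.forman e + σ * K.δadj (K.δ f) a ≤ K.deg e := by
  classical
  set s := coeff K.δ b e with hs
  have hss : s * s = 1 := hb.coeff_mul_self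
  have he : K.δ f e = s * σ := by rw [K.δ_edge hdim ha hb hab, hfab]
  have habs : |s * σ| = 1 := by
    rw [← abs_one (α := ℝ), ← sq_eq_sq_iff_abs_eq_abs]
    linear_combination σ ^ 2 * hss + hσ
  -- Removing `β` leaves only `e` at `b`, so `δ* α` at `b` is the single weight ratio of `e` and
  -- `b`, while nothing changes at `a`, as no other edge joins `a` and `b`.
  set β : X → ℝ := fun y => if y ≠ e ∧ K.IsFace b y then K.δ f y else 0 with hβ
  set α : X → ℝ := K.δ f - β with hα
  have hβe : β e = 0 := by simp [hβ]
  have hαe : α e = s * σ := by rw [hα, Pi.sub_apply, hβe, he, sub_zero]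
  have hα1 : ∀ y, |α y| ≤ 1 := by
    intro y
    simp only [hα, hβ, Pi.sub_apply]
    split_ifs
    · simp
    · simpa using hf y
  have hmax := K.forman_le_mul_hodge hα1 (x := e) (by rw [hαe, habs])
  have hadj_b : K.δadj α b = s * σ * (K.m e / K.m b) * s := by
    rw [δadj_apply, Finset.sum_eq_single e, hαe]
    · intro y _ hy
      by_cases hby : K.IsFace b y
      · have : α y = 0 := by simp [hα, hβ, hy, hby]
        rw [this, zero_mul, zero_mul]
      · rw [K.coeff_eq_zero hby, mul_zero]
    · simp
  have hadj_a : K.δadj α a = K.δadj (K.δ f) a := by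
    rw [hα, map_sub, Pi.sub_apply, sub_eq_self, δadj_apply]
    apply Finset.sum_eq_zero
    intro y _
    by_cases hay : K.IsFace a y
    · have : β y = 0 := by
        simp only [hβ]
        rw [if_neg]
        rintro ⟨hye, hby⟩
        exact hye (K.edge_unique hdim ha hb hab hay hby).symm
      rw [this, zero_mul, zero_mul]
    · rw [K.coeff_eq_zero hay, mul_zero]
  -- Here `δ α = -δ β`, and by the diamond property `z` has exactly one face `y ≠ e` containing `b`,
  -- so at most one term survives.
  have hδα : ∀ z, K.IsFace e z → |K.δ α z| ≤ 1 := by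
    intro z hz
    have hdz : K.dim z = K.dim b + 2 := by
      have := hz.dim_eq
      have := hb.dim_eq
      omega
    have hmem : e ∈ {x | coeff K.δ b x ≠ 0 ∧ coeff K.δ x z ≠ 0} := ⟨hb, hz⟩
    have hcard := K.diamond_card b z hdz ⟨e, hmem⟩
    obtain ⟨y, hy⟩ : ∃ y, {x | coeff K.δ b x ≠ 0 ∧ coeff K.δ x z ≠ 0} \ {e} = {y} := by
      rw [← Set.ncard_eq_one, Set.ncard_sdiff_singleton_of_mem hmem, hcard]
    have hyz : K.IsFace y z := (hy.ge rfl).1.2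
    rw [hα, map_sub, δ_δ, zero_sub, Pi.neg_apply, abs_neg, δ_apply, Finset.sum_eq_single y,
      abs_mul, hyz.abs_coeff, mul_one]
    · simp only [hβ]
      split_ifs
      · exact hf y
      · simp
    · intro x _ hxy
      by_contra h0
      have hβx : β x ≠ 0 := left_ne_zero_of_mul h0
      have hx : x ≠ e ∧ K.IsFace b x := by
        by_contra hc
        exact hβx (if_neg hc)
      have : x ∈ {x | coeff K.δ b x ≠ 0 ∧ coeff K.δ x z ≠ 0} \ {e} :=
        ⟨⟨hx.2, right_ne_zero_of_mul h0⟩, hx.1⟩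
      rw [hy] at this
      exact hxy this
    · simp
  have h1 : |K.δadj (K.δ α) e| ≤ _ := K.sum_div_le e hδα
  have h2 : s * σ * K.δadj (K.δ α) e ≤ |K.δadj (K.δ α) e| := by
    refine (le_abs_self _).trans ?_
    rw [abs_mul, habs, one_mul]
  rw [hαe, hodge_apply, Pi.add_apply, K.δ_edge hdim ha hb hab, hadj_a, hadj_b, mul_add] at hmax
  have h3 : s * σ * (coeff K.δ b e * (s * σ * (K.m e / K.m b) * s - K.δadj (K.δ f) a))
      = K.m e / K.m b - σ * K.δadj (K.δ f) a := by
    rw [← hs]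
    linear_combination (σ * σ * (K.m e / K.m b) * (s * s + 1) - σ * K.δadj (K.δ f) a) * hss +
      (K.m e / K.m b) * hσ
  have h4 := K.div_le_iSup_face hb
  rw [deg]
  linarith

/-! ### Path distance and geodesics -/

lemma Adj.exists_edge {K : CellComplex X} {a b : X} (h : K.Adj a b) (ha : K.dim a = 0) :
    K.dim b = 0 ∧ ∃ e, K.dim e = 1 ∧ K.IsFace a e ∧ K.IsFace b e := by
  rcases h with ⟨z, h1, h2⟩ | ⟨v, h1, -⟩
  · have := h1.dim_eq
    have := h2.dim_eq
    exact ⟨by omega, z, by omega, h1, h2⟩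
  · have := h1.dim_eq
    omega

lemma HasPath.append {K : CellComplex X} {x y z : X} {n : ℕ} (h : K.HasPath x y n)
    (hyz : K.Adj y z) : K.HasPath x z (n + 1) := by
  obtain ⟨p, hp0, hpn, hp⟩ := h
  refine ⟨fun k => if k ≤ n then p k else z, by simpa using hp0, by simp, fun k hk => ?_⟩
  rcases Nat.lt_succ_iff_lt_or_eq.mp hk with h | rfl
  · simpa [h.le, Nat.succ_le_of_lt h] using hp k h
  · simpa [hpn] using hyz

lemma cdist_le {x y : X} {n : ℕ} (h : K.HasPath x y n) : K.cdist x y ≤ n := iInf₂_le n h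

lemma exists_hasPath_cdist {x y : X} (h : ∃ n, K.HasPath x y n) :
    ∃ n : ℕ, K.HasPath x y n ∧ K.cdist x y = n := by
  classical
  refine ⟨Nat.find h, Nat.find_spec h, le_antisymm (K.cdist_le (Nat.find_spec h)) ?_⟩
  exact le_iInf₂ fun n hn => Nat.cast_le.mpr (Nat.find_min' h hn)

lemma toNat_cdist_le {x y : X} {n : ℕ} (h : K.HasPath x y n) : (K.cdist x y).toNat ≤ n :=
  ENat.toNat_le_of_le_natCast (K.cdist_le h)

lemma toNat_cdist_le_add_one {x y z : X} (h : K.Adj y z) (h' : K.Adj z y) :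
    (K.cdist x z).toNat ≤ (K.cdist x y).toNat + 1 := by
  by_cases hy : ∃ n, K.HasPath x y n
  · obtain ⟨n, hn, hd⟩ := K.exists_hasPath_cdist hy
    rw [hd, ENat.toNat_natCast]
    exact K.toNat_cdist_le (hn.append h)
  · have hz : K.cdist x z = ⊤ := by
      refine iInf₂_eq_top.mpr fun n hn => ?_
      exact absurd ⟨n + 1, hn.append h'⟩ hy
    simp [hz]

open Classical in
/-- The distance from `v` as a function on the vertices, extended by zero to all cells. -/
noncomputable def distFrom (v : X) : X → ℝ :=
  fun x => if K.dim x = 0 then ((K.cdist v x).toNat : ℝ) else 0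

lemma abs_δ_distFrom_le (v z : X) : |K.δ (K.distFrom v) z| ≤ 1 := by
  by_cases hdim : K.dim z = 1
  · obtain ⟨a, b, hab, ha, hb⟩ := K.exists_faces hdim
    have hda : K.dim a = 0 := by have := ha.dim_eq; omega
    have hdb : K.dim b = 0 := by have := hb.dim_eq; omega
    have hAB : K.Adj a b := Or.inl ⟨z, ha, hb⟩
    have hBA : K.Adj b a := Or.inl ⟨z, hb, ha⟩
    rw [K.δ_edge hdim ha hb hab, abs_mul, hb.abs_coeff, one_mul]
    simp only [distFrom, hda, hdb, if_true]
    have h1 := K.toNat_cdist_le_add_one (x := v) hAB hBA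
    have h2 := K.toNat_cdist_le_add_one (x := v) hBA hAB
    rw [abs_le]
    constructor <;> rw [← Nat.cast_le (α := ℝ)] at h1 h2 <;> push_cast at h1 h2 <;> linarith
  · rw [δ_apply, Finset.sum_eq_zero, abs_zero]
    · exact zero_le_one
    · intro x _
      by_cases hx : K.dim x = 0
      · rw [K.coeff_dim x z (by omega), mul_zero]
      · simp [distFrom, hx]

/-- A geodesic between vertices, along which the distance from the starting point grows with
slope one. -/
lemma exists_geodesic {v w : X} (hv : K.dim v = 0) (h : ∃ n, K.HasPath v w n) :
    ∃ (n : ℕ) (p : ℕ → X), K.cdist v w = n ∧ p 0 = v ∧ p n = w ∧ (∀ k ≤ n, K.dim (p k) = 0) ∧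
      (∀ k < n, p k ≠ p (k + 1) ∧ K.distFrom v (p (k + 1)) - K.distFrom v (p k) = 1 ∧
        ∃ e, K.dim e = 1 ∧ K.IsFace (p k) e ∧ K.IsFace (p (k + 1)) e) := by
  obtain ⟨n, ⟨p, hp0, hpn, hp⟩, hd⟩ := K.exists_hasPath_cdist h
  have hdim : ∀ k ≤ n, K.dim (p k) = 0 := by
    intro k
    induction k with
    | zero => intro _; rw [hp0, hv]
    | succ k ih => intro hk; exact ((hp k hk).exists_edge (ih (by omega))).1
  have hup : ∀ k ≤ n, (K.cdist v (p k)).toNat ≤ k := fun k hk =>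
    K.toNat_cdist_le ⟨p, hp0, rfl, fun j hj => hp j (by omega)⟩
  have hstep : ∀ k < n, (K.cdist v (p (k + 1))).toNat ≤ (K.cdist v (p k)).toNat + 1 := by
    intro k hk
    obtain ⟨-, e, -, h1, h2⟩ := (hp k hk).exists_edge (hdim k hk.le)
    exact K.toNat_cdist_le_add_one (Or.inl ⟨e, h1, h2⟩) (Or.inl ⟨e, h2, h1⟩)
  -- Going back from `w`, the distance drops by at most one per step; with `hup` this makes it
  -- exactly `k` at `p k`.
  have hlow : ∀ j ≤ n, n ≤ (K.cdist v (p (n - j))).toNat + j := by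
    intro j
    induction j with
    | zero => intro _; simp [hpn, hd]
    | succ j ih =>
      intro hj
      have h1 := ih (by omega)
      have h2 := hstep (n - (j + 1)) (by omega)
      rw [show n - (j + 1) + 1 = n - j by omega] at h2
      omega
  have heq : ∀ k ≤ n, K.distFrom v (p k) = k := by
    intro k hk
    have h1 := hup k hk
    have h2 := hlow (n - k) (by omega)
    rw [show n - (n - k) = k by omega] at h2
    simp only [distFrom, hdim k hk, if_true, Nat.cast_inj]
    omega
  refine ⟨n, p, hd, hp0, hpn, hdim, fun k hk => ?_⟩
  have hk1 := heq (k + 1) hk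
  have hk0 := heq k hk.le
  push_cast at hk1
  refine ⟨fun h => ?_, by linarith, ((hp k hk).exists_edge (hdim k hk.le)).2⟩
  rw [← h] at hk1
  linarith

/-! ### The two bounds and the conclusion -/

/-- The distance bound for two vertices joined by a path. -/
lemma exists_cdist_eq_mul_le {R : ℝ} (hF : ∀ x, K.dim x = 1 → R ≤ K.forman x) {v w : X}
    (hv : K.dim v = 0) (h : ∃ n, K.HasPath v w n) :
    ∃ n : ℕ, K.cdist v w = n ∧ n * R ≤ 2 * min (K.maxDeg 1) (K.maxDeg 0) := by
  obtain ⟨n, p, hd, -, -, hdim, hedge⟩ := K.exists_geodesic hv h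
  refine ⟨n, hd, ?_⟩
  set f := K.distFrom v with hf
  have hf1 : ∀ z, |K.δ f z| ≤ 1 := K.abs_δ_distFrom_le v
  set g := K.δadj (K.δ f) with hg
  have hmono : ∀ i j, i + j ≤ n → j * R ≤ g (p (i + j)) - g (p i) := by
    intro i j
    induction j with
    | zero => intro _; simp
    | succ j ih =>
      intro hj
      have h1 := ih (by omega)
      obtain ⟨hne, hone, e, he, ha, hb⟩ := hedge (i + j) (by omega)
      have h2 := (hF e he).trans (K.forman_le_sub hf1 he ha hb hne hone)
      push_cast
      rw [← add_assoc]
      linarith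
  have hdeg0 : ∀ k ≤ n, |g (p k)| ≤ K.maxDeg 0 := fun k hk =>
    (K.abs_δadj_le_deg _ hf1).trans (hdim k hk ▸ K.deg_le_maxDeg (p k))
  have hdeg1 : ∀ e, K.dim e = 1 → K.deg e ≤ K.maxDeg 1 := fun e he => he ▸ K.deg_le_maxDeg e
  rw [mul_min_of_nonneg _ _ (by norm_num : (0 : ℝ) ≤ 2)]
  refine le_min ?_ ?_
  · obtain rfl | rfl | ⟨j, rfl⟩ : n = 0 ∨ n = 1 ∨ ∃ j, n = j + 2 := by
      rcases n with _ | _ | j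
      exacts [Or.inl rfl, Or.inr (Or.inl rfl), Or.inr (Or.inr ⟨j, rfl⟩)]
    · have := K.maxDeg_nonneg 1
      simpa using this
    · obtain ⟨-, -, e, he, -, -⟩ := hedge 0 (by norm_num)
      have h1 := hF e he
      have h2 := K.forman_le_two_mul_deg he
      have h3 := hdeg1 e he
      push_cast
      linarith
    · have hmid := hmono 1 j (by omega)
      obtain ⟨hne, hone, e, he, ha, hb⟩ := hedge (1 + j) (by omega)
      have h1 := K.forman_add_le_deg hf1 he ha hb hne (σ := 1) (by norm_num) hone
      obtain ⟨hne', hone', e', he', ha', hb'⟩ := hedge 0 (by omega)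
      -- The first edge is read backwards, with inner vertex `p 1` and outer vertex `p 0`, hence `σ
      -- = -1`. The values of `g` at the inner vertices then cancel against `hmid`.
      have h2 := K.forman_add_le_deg hf1 he' hb' ha' hne'.symm (σ := -1) (by norm_num)
        (by linarith)
      rw [← hg] at h1 h2
      rw [zero_add] at h2
      have := hF e he
      have := hF e' he'
      have := hdeg1 e he
      have := hdeg1 e' he'
      push_cast
      linarith
  · have h1 := hmono 0 n (by omega)
    have h2 := (abs_le.mp (hdeg0 (0 + n) (by omega))).2
    have h3 := (abs_le.mp (hdeg0 0 (by omega))).1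
    linarith

end CellComplex

/-- Rounding the real bound down allows the supremum defining the diameter to be bounded within
`ℕ∞`. -/
lemma coe_le_of_le_floor {c : ℕ∞} {r : ℝ} (hr : 0 ≤ r) (h : c ≤ (⌊r⌋₊ : ℕ∞)) :
    ((c : ENNReal) : EReal) ≤ (r : EReal) := by
  lift c to ℕ using ne_top_of_le_ne_top (ENat.natCast_ne_top _) h
  have h1 : (c : ℝ) ≤ r := (Nat.le_floor_iff hr).mp (Nat.cast_le.mp h)
  have h2 : (((c : ℕ∞) : ENNReal) : EReal) = ((c : ℝ) : EReal) := rfl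
  rw [h2]
  exact EReal.coe_le_coe_iff.mpr h1

end FormanDiam

theorem mainTheorem5 {X : Type*} [Fintype X] (K : FormanDiam.CellComplex X) (R : ℝ)
    (hR : 0 < R) (hF : ∀ x, K.dim x = 1 → R ≤ K.forman x) :
    (∀ v w, K.dim v = 0 → K.dim w = 0 → (∃ n, K.HasPath v w n) →
      ((K.cdist v w : ENNReal) : EReal) ≤
        ((2 * min (K.maxDeg 1) (K.maxDeg 0) / R : ℝ) : EReal)) ∧
    (K.Connected →
      ((K.diam : ENNReal) : EReal) ≤
        ((2 * min (K.maxDeg 1) (K.maxDeg 0) / R : ℝ) : EReal)) := by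
  have hr : 0 ≤ 2 * min (K.maxDeg 1) (K.maxDeg 0) / R := by
    have := le_min (K.maxDeg_nonneg 1) (K.maxDeg_nonneg 0)
    positivity
  have key : ∀ v w, K.dim v = 0 → (∃ n, K.HasPath v w n) →
      K.cdist v w ≤ (⌊2 * min (K.maxDeg 1) (K.maxDeg 0) / R⌋₊ : ℕ∞) := by
    intro v w hv h
    obtain ⟨n, hn, hle⟩ := K.exists_cdist_eq_mul_le hF hv h
    rw [hn]
    exact Nat.cast_le.mpr (Nat.le_floor ((le_div_iff₀ hR).mpr hle))
  refine ⟨fun v w hv _ h => FormanDiam.coe_le_of_le_floor hr (key v w hv h), fun hc => ?_⟩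
  exact FormanDiam.coe_le_of_le_floor hr
    (iSup₂_le fun v w => key v w v.2 (hc v w v.2 w.2))
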